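/- Let $\mathbb K\in\{\mathbb R,\mathbb C\}$. A \emph{ProP} is a family $P=(P(k,l))_{k,l\ge 0}$ of $\mathbb K$-vector spaces with: commuting linear left $\mathfrak S_l$- and right $\mathfrak S_k$-actions on $P(k,l)$; a bilinear associative horizontal concatenation $*:P(k,l)\times P(k',l')\to P(k+k',l+l')$ with unit $I_0\in P(0,0)$; a bilinear associative vertical concatenation $\circ:P(l,m)\times P(k,l)\to P(k,m)$ and an element $I_1\in P(1,1)$ such that $p\circ I_k=I_l\circ p=p$ for $p\in P(k,l)$, where $I_n=I_1^{*n}$ and $I_1^{*0}=I_0$; such that, whenever defined, $$(p*p')\circ(q*q')=(p\circ q)*(p'\circ q'),$$ $$\sigma\cdot(p\circ q)=(\sigma\cdot p)\circ q,\quad (p\circ q)\cdot\nu=p\circ(q\cdot\nu),\quad (p\cdot\tau)\circ q=p\circ(\tau\cdot q),$$ $$(\sigma\cdot p)*(\sigma'\cdot p')=(\sigma\otimes\sigma')\cdot(p*p'),\quad (p\cdot\tau)*(p'\cdot\tau')=(p*p')\cdot(\tau\otimes\tau'),$$ $$c_{l,l'}\cdot(p*p')=(p'*p)\cdot c_{k,k'}\qquad(p\in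 P(k,l),\ p'\in P(k',l')).$$ Here $\sigma\otimes\sigma'$ is the block permutation, and $c_{m,n}\in\mathfrak S_{m+n}$ is given by $i\mapsto i+n$ for $i\le m$ and $i\mapsto i-m$ for $i>m$. Let $V$ be a Fréchet nuclear space over $\mathbb K$, that is, a complete Hausdorff topological vector space whose topology is defined by a family of seminorms (countability of the family is not needed), such that for every locally convex space $F$ the $\varepsilon$-topology and the projective topology on $V\otimes F$ coincide. Let $V^{\hat\otimes n}$ be the completion of $V^{\otimes n}$ for the projective topology, and for $\sigma\in\mathfrak S_n$ let $\overline{\theta_\sigma}$ be the continuous endomorphism of $V^{\hat\otimes n}$ that extends $v_1\otimes\cdots\otimes v_n\mapsto v_{\sigma^{-1}(1)}\otimes\cdots\otimes v_{\sigma^{-1}(n)}$. There are canonical isomorphisms of topological vector spaces $V^{\hat\otimes 0}\simeq\mathbb K$, $V^{\hat\otimes 1}\simeq V$ and $V^{\hat\otimes k}\hat\otimes V^{\hat\otimes l}\simeq V^{\hat\otimes(k+l)}$, given on pure tensors by the evident formulas. With these identifications, the family $$\mathbf{Hom}^c_V(k,l)=\mathbf{Hom}^c(V^{\hat\otimes k},V^{\hat\otimes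 l})\qquad(k,l\ge 0)$$ of spaces of continuous linear maps is a ProP for the following operations: the actions are $\sigma\cdot f=\overline{\theta_\sigma}\circ f$ and $f\cdot\tau=f\circ\overline{\theta_\tau}$; the horizontal concatenation is the completed tensor product of maps $f*g=f\hat\otimes g$, with $I_0=\mathrm{Id}_{\mathbb K}$; the vertical concatenation is the composition of maps, with $I_1=\mathrm{Id}_V$. -/

import Mathlib

open scoped TensorProduct UniformConvergence

universe u v w

noncomputable section

/-! ### ProPs -/

/-- Transport of an element of `P k l` along equalities of the indices. -/
def castIdx {P : ℕ → ℕ → Type w} {k k' l l' : ℕ} (hk : k = k') (hl : l = l') (p : P k l) :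
    P k' l' :=
  hk ▸ hl ▸ p

/-- The block permutation `α ⊗ β` of `{1, …, m + n}`: it acts as `α` on the first `m` elements and
as `β` (shifted by `m`) on the last `n`. -/
def blockPerm {m n : ℕ} (α : Equiv.Perm (Fin m)) (β : Equiv.Perm (Fin n)) :
    Equiv.Perm (Fin (m + n)) :=
  finSumFinEquiv.permCongr (Equiv.sumCongr α β)

/-- The block transposition `c_{m,n}` of `{1, …, m + n}`: `i ↦ i + n` for `i ≤ m` and `i ↦ i - m`
for `i > m`. -/
def blockSwap (m n : ℕ) : Equiv.Perm (Fin (m + n)) :=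
  finAddFlip.trans (finCongr (Nat.add_comm n m))

/-- The operations of a ProP on a family `P(k,l)` of vector spaces. -/
structure ProPData (𝕜 : Type v) [Field 𝕜] (P : ℕ → ℕ → Type w)
    [∀ k l, AddCommGroup (P k l)] [∀ k l, Module 𝕜 (P k l)] where
  /-- The left action `σ · p` of the symmetric group on `l` letters. -/
  lact {k l : ℕ} (σ : Equiv.Perm (Fin l)) : P k l →ₗ[𝕜] P k l
  /-- The right action `p · τ` of the symmetric group on `k` letters. -/
  ract {k l : ℕ} (τ : Equiv.Perm (Fin k)) : P k l →ₗ[𝕜] P k l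
  /-- The horizontal concatenation `p * p'`. -/
  hcomp {k l k' l' : ℕ} : P k l →ₗ[𝕜] P k' l' →ₗ[𝕜] P (k + k') (l + l')
  /-- The horizontal unit `I₀`. -/
  I₀ : P 0 0
  /-- The vertical concatenation `p ∘ q`. -/
  vcomp {k l m : ℕ} : P l m →ₗ[𝕜] P k l →ₗ[𝕜] P k m
  /-- The element `I₁`. -/
  I₁ : P 1 1

/-- The powers `I_n = I₁ * ⋯ * I₁` (`n` factors), with `I_0 = I₀`. -/
def ProPData.idn {𝕜 : Type v} [Field 𝕜] {P : ℕ → ℕ → Type w}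
    [∀ k l, AddCommGroup (P k l)] [∀ k l, Module 𝕜 (P k l)] (D : ProPData 𝕜 P) :
    ∀ n : ℕ, P n n
  | 0 => D.I₀
  | n + 1 => D.hcomp (D.idn n) D.I₁

/-- A ProP structure on a family `P(k,l)` of vector spaces. -/
structure ProP (𝕜 : Type v) [Field 𝕜] (P : ℕ → ℕ → Type w)
    [∀ k l, AddCommGroup (P k l)] [∀ k l, Module 𝕜 (P k l)] extends ProPData 𝕜 P where
  one_lact {k l : ℕ} (p : P k l) : lact 1 p = p
  ract_one {k l : ℕ} (p : P k l) : ract 1 p = p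
  lact_lact {k l : ℕ} (σ σ' : Equiv.Perm (Fin l)) (p : P k l) :
    lact σ (lact σ' p) = lact (σ * σ') p
  lact_ract {k l : ℕ} (σ : Equiv.Perm (Fin l)) (τ : Equiv.Perm (Fin k)) (p : P k l) :
    lact σ (ract τ p) = ract τ (lact σ p)
  ract_ract {k l : ℕ} (τ τ' : Equiv.Perm (Fin k)) (p : P k l) :
    ract τ' (ract τ p) = ract (τ * τ') p
  hcomp_assoc {k l k' l' k'' l'' : ℕ} (p : P k l) (p' : P k' l') (p'' : P k'' l'') :
    hcomp p (hcomp p' p'') =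
      castIdx (Nat.add_assoc k k' k'') (Nat.add_assoc l l' l'') (hcomp (hcomp p p') p'')
  hcomp_I₀ {k l : ℕ} (p : P k l) :
    castIdx (Nat.add_zero k) (Nat.add_zero l) (hcomp p I₀) = p
  I₀_hcomp {k l : ℕ} (p : P k l) :
    castIdx (Nat.zero_add k) (Nat.zero_add l) (hcomp I₀ p) = p
  vcomp_assoc {k l m n : ℕ} (p : P m n) (q : P l m) (r : P k l) :
    vcomp p (vcomp q r) = vcomp (vcomp p q) r
  vcomp_idn {k l : ℕ} (p : P k l) : vcomp p (toProPData.idn k) = p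
  idn_vcomp {k l : ℕ} (p : P k l) : vcomp (toProPData.idn l) p = p
  hcomp_vcomp_hcomp {k k' l l' m m' : ℕ} (p : P l m) (p' : P l' m') (q : P k l) (q' : P k' l') :
    vcomp (hcomp p p') (hcomp q q') = hcomp (vcomp p q) (vcomp p' q')
  lact_vcomp {k l m : ℕ} (σ : Equiv.Perm (Fin m)) (p : P l m) (q : P k l) :
    lact σ (vcomp p q) = vcomp (lact σ p) q
  vcomp_ract {k l m : ℕ} (ν : Equiv.Perm (Fin k)) (p : P l m) (q : P k l) :
    ract ν (vcomp p q) = vcomp p (ract ν q)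
  ract_vcomp {k l m : ℕ} (τ : Equiv.Perm (Fin l)) (p : P l m) (q : P k l) :
    vcomp (ract τ p) q = vcomp p (lact τ q)
  lact_hcomp {k k' l l' : ℕ} (σ : Equiv.Perm (Fin l)) (σ' : Equiv.Perm (Fin l'))
    (p : P k l) (p' : P k' l') :
    hcomp (lact σ p) (lact σ' p') = lact (blockPerm σ σ') (hcomp p p')
  hcomp_ract {k k' l l' : ℕ} (τ : Equiv.Perm (Fin k)) (τ' : Equiv.Perm (Fin k'))
    (p : P k l) (p' : P k' l') :
    hcomp (ract τ p) (ract τ' p') = ract (blockPerm τ τ') (hcomp p p')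
  hcomp_comm {k k' l l' : ℕ} (p : P k l) (p' : P k' l') :
    lact (blockSwap l l') (hcomp p p') =
      ract (blockSwap k k') (castIdx (Nat.add_comm k' k) (Nat.add_comm l' l) (hcomp p' p))

/-! ### The projective topology on `E ⊗ F` and the completed tensor product -/

section Binary

variable (𝕜 : Type v) [RCLike 𝕜] (E F : Type*)
  [AddCommGroup E] [Module 𝕜 E] [TopologicalSpace E]
  [AddCommGroup F] [Module 𝕜 F] [TopologicalSpace F]

/-- The projective topology on `E ⊗ F`: the finest locally convex vector space topology for which
the canonical bilinear map `E × F → E ⊗ F` is continuous. (Finer topologies are smaller in the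
order on `TopologicalSpace`; `PolynormableSpace 𝕜` says that the topology is defined by
seminorms.) -/
@[reducible] def projTopology : TopologicalSpace (E ⊗[𝕜] F) :=
  sInf {t | @IsTopologicalAddGroup (E ⊗[𝕜] F) t _ ∧ @ContinuousSMul 𝕜 (E ⊗[𝕜] F) _ _ t ∧
    @PolynormableSpace 𝕜 (E ⊗[𝕜] F) _ _ _ t ∧
    @Continuous (E × F) (E ⊗[𝕜] F) _ t fun x => x.1 ⊗ₜ[𝕜] x.2}

/-- The `ε`-topology on `E ⊗ F`: a tensor `z` is regarded as the bilinear form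
`(x', y') ↦ (x' ⊗ y') z` on `E' × F'`, and these forms carry the topology of uniform convergence
on the products of an equicontinuous subset of `E'` with an equicontinuous subset of `F'`. -/
@[reducible] def epsTopology : TopologicalSpace (E ⊗[𝕜] F) :=
  TopologicalSpace.induced
    (fun z => UniformOnFun.ofFun
      {S : Set ((E →L[𝕜] 𝕜) × (F →L[𝕜] 𝕜)) | ∃ (A : Set (E →L[𝕜] 𝕜)) (B : Set (F →L[𝕜] 𝕜)),
        Equicontinuous (fun (f : A) (x : E) => f.1 x) ∧
        Equicontinuous (fun (g : B) (y : F) => g.1 y) ∧ S = A ×ˢ B}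
      (fun q => TensorProduct.dualDistrib 𝕜 E F
        ((q.1 : E →ₗ[𝕜] 𝕜) ⊗ₜ[𝕜] (q.2 : F →ₗ[𝕜] 𝕜)) z))
    inferInstance

/-- `E ⊗ F` with the projective topology. -/
def ProjTensor : Type _ := E ⊗[𝕜] F

instance : AddCommGroup (ProjTensor 𝕜 E F) := inferInstanceAs (AddCommGroup (E ⊗[𝕜] F))

instance : Module 𝕜 (ProjTensor 𝕜 E F) := inferInstanceAs (Module 𝕜 (E ⊗[𝕜] F))

theorem ProjTensor.isTopologicalAddGroup_projTopology :
    @IsTopologicalAddGroup (ProjTensor 𝕜 E F) (projTopology 𝕜 E F) _ :=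
  topologicalAddGroup_sInf fun _ h => h.1

/-- The uniform structure of the projective topology. -/
instance : UniformSpace (ProjTensor 𝕜 E F) :=
  @IsTopologicalAddGroup.rightUniformSpace (ProjTensor 𝕜 E F) _ (projTopology 𝕜 E F)
    (ProjTensor.isTopologicalAddGroup_projTopology 𝕜 E F)

instance : IsTopologicalAddGroup (ProjTensor 𝕜 E F) :=
  ProjTensor.isTopologicalAddGroup_projTopology 𝕜 E F

instance : IsUniformAddGroup (ProjTensor 𝕜 E F) :=
  @isUniformAddGroup_of_addCommGroup (ProjTensor 𝕜 E F) _ (projTopology 𝕜 E F)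
    (ProjTensor.isTopologicalAddGroup_projTopology 𝕜 E F)

instance : ContinuousSMul 𝕜 (ProjTensor 𝕜 E F) :=
  @continuousSMul_sInf 𝕜 (E ⊗[𝕜] F) _ _ _ fun _ h => h.2.1

instance : UniformContinuousConstSMul 𝕜 (ProjTensor 𝕜 E F) :=
  uniformContinuousConstSMul_of_continuousConstSMul 𝕜 _

instance : PolynormableSpace 𝕜 (ProjTensor 𝕜 E F) :=
  PolynormableSpace.sInf (E := E ⊗[𝕜] F) fun _ h => h.2.2.1

/-- The canonical bilinear map `E × F → E ⊗ F`. -/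
def ProjTensor.mk : E →ₗ[𝕜] F →ₗ[𝕜] ProjTensor 𝕜 E F := TensorProduct.mk 𝕜 E F

/-- The completed (projective) tensor product `E ⊗̂ F`. -/
abbrev CompletedTensor : Type _ := UniformSpace.Completion (ProjTensor 𝕜 E F)

variable {E F}

/-- The element `x ⊗ y` of `E ⊗̂ F`. -/
def CompletedTensor.tmul (x : E) (y : F) : CompletedTensor 𝕜 E F :=
  (ProjTensor.mk 𝕜 E F x y : ProjTensor 𝕜 E F)

variable {𝕜} {E' F' : Type*}
  [AddCommGroup E'] [Module 𝕜 E'] [TopologicalSpace E']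
  [AddCommGroup F'] [Module 𝕜 F'] [TopologicalSpace F']

theorem ProjTensor.continuous_tmul :
    Continuous fun x : E × F => ProjTensor.mk 𝕜 E F x.1 x.2 :=
  continuous_sInf_rng.2 fun _ h => h.2.2.2

/-- A linear map from `E ⊗ F` to a locally convex space is continuous for the projective topology
as soon as the associated bilinear map is continuous. -/
theorem ProjTensor.continuous_of_tmul {G : Type*} [AddCommGroup G] [Module 𝕜 G]
    [TopologicalSpace G] [IsTopologicalAddGroup G] [ContinuousSMul 𝕜 G] [PolynormableSpace 𝕜 G]
    (T : ProjTensor 𝕜 E F →ₗ[𝕜] G)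
    (hT : Continuous fun x : E × F => T (ProjTensor.mk 𝕜 E F x.1 x.2)) : Continuous T := by
  rw [continuous_iff_le_induced]
  exact sInf_le ⟨topologicalAddGroup_induced T, continuousSMul_induced T,
    PolynormableSpace.induced T, continuous_induced_rng.2 hT⟩

/-- The tensor product `f ⊗ g` of two continuous linear maps, as a linear map. -/
def ProjTensor.mapₗ (f : E →L[𝕜] E') (g : F →L[𝕜] F') :
    ProjTensor 𝕜 E F →ₗ[𝕜] ProjTensor 𝕜 E' F' :=
  TensorProduct.map (f : E →ₗ[𝕜] E') (g : F →ₗ[𝕜] F')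

/-- The tensor product `f ⊗ g` of two continuous linear maps is continuous for the projective
topologies. -/
def ProjTensor.map (f : E →L[𝕜] E') (g : F →L[𝕜] F') :
    ProjTensor 𝕜 E F →L[𝕜] ProjTensor 𝕜 E' F' where
  toLinearMap := ProjTensor.mapₗ f g
  cont := ProjTensor.continuous_of_tmul (ProjTensor.mapₗ f g)
    (ProjTensor.continuous_tmul.comp
      ((f.continuous.comp continuous_fst).prodMk (g.continuous.comp continuous_snd)))

/-- The completed tensor product `f ⊗̂ g : E ⊗̂ F → E' ⊗̂ F'` of two continuous linear maps. -/
def CompletedTensor.map (f : E →L[𝕜] E') (g : F →L[𝕜] F') :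
    CompletedTensor 𝕜 E F →L[𝕜] CompletedTensor 𝕜 E' F' :=
  (ProjTensor.map f g).completion

theorem CompletedTensor.map_tmul (f : E →L[𝕜] E') (g : F →L[𝕜] F') (x : E) (y : F) :
    CompletedTensor.map f g (CompletedTensor.tmul 𝕜 x y) = CompletedTensor.tmul 𝕜 (f x) (g y) :=
  ContinuousLinearMap.completion_apply_coe (ProjTensor.map f g) _

end Binary

/-! ### Fréchet and nuclear spaces -/

/-- A Hausdorff complete topological vector space whose topology is defined by a family of
seminorms. The family is not required to be countable: Fréchet spaces in the classical, metrizable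
sense are included, and so are all other complete Hausdorff locally convex spaces. -/
structure IsFrechet (𝕜 : Type v) [RCLike 𝕜] (V : Type u) [AddCommGroup V] [Module 𝕜 V]
    [UniformSpace V] : Prop where
  t2 : T2Space V
  complete : CompleteSpace V
  polynormable : PolynormableSpace 𝕜 V

/-- A locally convex space `E` is nuclear if `E ⊗̂_ε F = E ⊗̂_π F` for all locally convex spaces
`F`, that is, if the `ε`-topology and the projective topology on `E ⊗ F` coincide (each of them is
induced by the topology of the corresponding completion). -/
def IsNuclear (𝕜 : Type v) [RCLike 𝕜] (E : Type u) [AddCommGroup E] [Module 𝕜 E]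
    [TopologicalSpace E] : Prop :=
  PolynormableSpace 𝕜 E ∧
  ∀ (F : Type u) [AddCommGroup F] [Module 𝕜 F] [TopologicalSpace F] [IsTopologicalAddGroup F]
    [ContinuousSMul 𝕜 F] [PolynormableSpace 𝕜 F], epsTopology 𝕜 E F = projTopology 𝕜 E F

/-! ### Completed tensor powers -/

section Power

variable (𝕜 : Type v) [RCLike 𝕜] (V : Type u) [AddCommGroup V] [Module 𝕜 V] [TopologicalSpace V]

/-- The algebraic tensor power `V^{⊗ n}`. It carries the projective topology, see below. -/
def TensorPow (n : ℕ) : Type _ := ⨂[𝕜] _ : Fin n, V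

variable (n : ℕ)

instance : AddCommGroup (TensorPow 𝕜 V n) := inferInstanceAs (AddCommGroup (⨂[𝕜] _ : Fin n, V))

instance : Module 𝕜 (TensorPow 𝕜 V n) := inferInstanceAs (Module 𝕜 (⨂[𝕜] _ : Fin n, V))

/-- The projective topology on `V^{⊗ n}`: the finest locally convex vector space topology for which
the canonical multilinear map `V × ⋯ × V → V^{⊗ n}` is continuous. -/
@[reducible] def projPowTopology : TopologicalSpace (⨂[𝕜] _ : Fin n, V) :=
  sInf {t | @IsTopologicalAddGroup (⨂[𝕜] _ : Fin n, V) t _ ∧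
    @ContinuousSMul 𝕜 (⨂[𝕜] _ : Fin n, V) _ _ t ∧
    @PolynormableSpace 𝕜 (⨂[𝕜] _ : Fin n, V) _ _ _ t ∧
    @Continuous (Fin n → V) (⨂[𝕜] _ : Fin n, V) _ t fun x => PiTensorProduct.tprod 𝕜 x}

theorem TensorPow.isTopologicalAddGroup_projPowTopology :
    @IsTopologicalAddGroup (TensorPow 𝕜 V n) (projPowTopology 𝕜 V n) _ :=
  topologicalAddGroup_sInf fun _ h => h.1

/-- The uniform structure of the projective topology. -/
instance : UniformSpace (TensorPow 𝕜 V n) :=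
  @IsTopologicalAddGroup.rightUniformSpace (TensorPow 𝕜 V n) _ (projPowTopology 𝕜 V n)
    (TensorPow.isTopologicalAddGroup_projPowTopology 𝕜 V n)

instance : IsTopologicalAddGroup (TensorPow 𝕜 V n) :=
  TensorPow.isTopologicalAddGroup_projPowTopology 𝕜 V n

instance : IsUniformAddGroup (TensorPow 𝕜 V n) :=
  @isUniformAddGroup_of_addCommGroup (TensorPow 𝕜 V n) _ (projPowTopology 𝕜 V n)
    (TensorPow.isTopologicalAddGroup_projPowTopology 𝕜 V n)

instance : ContinuousSMul 𝕜 (TensorPow 𝕜 V n) :=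
  @continuousSMul_sInf 𝕜 (⨂[𝕜] _ : Fin n, V) _ _ _ fun _ h => h.2.1

instance : UniformContinuousConstSMul 𝕜 (TensorPow 𝕜 V n) :=
  uniformContinuousConstSMul_of_continuousConstSMul 𝕜 _

instance : PolynormableSpace 𝕜 (TensorPow 𝕜 V n) :=
  PolynormableSpace.sInf (E := ⨂[𝕜] _ : Fin n, V) fun _ h => h.2.2.1

/-- The canonical multilinear map `V × ⋯ × V → V^{⊗ n}`. -/
def TensorPow.tprod : MultilinearMap 𝕜 (fun _ : Fin n => V) (TensorPow 𝕜 V n) :=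
  PiTensorProduct.tprod 𝕜

/-- The completed tensor power `V^{⊗̂ n}`. -/
abbrev CompletedPow : Type _ := UniformSpace.Completion (TensorPow 𝕜 V n)

variable {V n}

/-- The element `v₁ ⊗ ⋯ ⊗ v_n` of `V^{⊗̂ n}`. -/
def CompletedPow.tprod (x : Fin n → V) : CompletedPow 𝕜 V n :=
  (TensorPow.tprod 𝕜 V n x : TensorPow 𝕜 V n)

theorem TensorPow.continuous_tprod :
    Continuous fun x : Fin n → V => TensorPow.tprod 𝕜 V n x :=
  continuous_sInf_rng.2 fun _ h => h.2.2.2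

variable {𝕜}

/-- A linear map from `V^{⊗ n}` to a locally convex space is continuous as soon as the associated
multilinear map is continuous. -/
theorem TensorPow.continuous_of_tprod {G : Type*} [AddCommGroup G] [Module 𝕜 G]
    [TopologicalSpace G] [IsTopologicalAddGroup G] [ContinuousSMul 𝕜 G] [PolynormableSpace 𝕜 G]
    (T : TensorPow 𝕜 V n →ₗ[𝕜] G)
    (hT : Continuous fun x : Fin n → V => T (TensorPow.tprod 𝕜 V n x)) : Continuous T := by
  rw [continuous_iff_le_induced]
  exact sInf_le ⟨topologicalAddGroup_induced T, continuousSMul_induced T,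
    PolynormableSpace.induced T, continuous_induced_rng.2 hT⟩

/-- The endomorphism `θ_σ` of `V^{⊗ n}`, see `TensorPow.theta_tprod`. -/
def TensorPow.thetaₗ (σ : Equiv.Perm (Fin n)) : TensorPow 𝕜 V n →ₗ[𝕜] TensorPow 𝕜 V n :=
  (PiTensorProduct.reindex 𝕜 (fun _ : Fin n => V) σ).toLinearMap

set_option linter.unusedSectionVars false in
/-- `θ_σ (v₁ ⊗ ⋯ ⊗ v_n) = v_{σ⁻¹(1)} ⊗ ⋯ ⊗ v_{σ⁻¹(n)}`. -/
theorem TensorPow.theta_tprod (σ : Equiv.Perm (Fin n)) (x : Fin n → V) :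
    TensorPow.thetaₗ σ (TensorPow.tprod 𝕜 V n x) = TensorPow.tprod 𝕜 V n fun i => x (σ⁻¹ i) :=
  PiTensorProduct.reindex_tprod σ x

/-- `θ_σ` is continuous for the projective topology. -/
def TensorPow.theta (σ : Equiv.Perm (Fin n)) : TensorPow 𝕜 V n →L[𝕜] TensorPow 𝕜 V n where
  toLinearMap := TensorPow.thetaₗ σ
  cont := TensorPow.continuous_of_tprod _ <|
    ((TensorPow.continuous_tprod 𝕜).comp
      (continuous_pi fun i => continuous_apply (σ⁻¹ i))).congr
        fun x => (TensorPow.theta_tprod σ x).symm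

/-- The continuous extension of `θ_σ` to `V^{⊗̂ n}`. -/
def CompletedPow.theta (σ : Equiv.Perm (Fin n)) : CompletedPow 𝕜 V n →L[𝕜] CompletedPow 𝕜 V n :=
  (TensorPow.theta σ).completion

theorem CompletedPow.theta_tprod (σ : Equiv.Perm (Fin n)) (x : Fin n → V) :
    CompletedPow.theta σ (CompletedPow.tprod 𝕜 x) = CompletedPow.tprod 𝕜 fun i => x (σ⁻¹ i) :=
  (ContinuousLinearMap.completion_apply_coe (TensorPow.theta σ) _).trans
    (congrArg _ (TensorPow.theta_tprod σ x))

variable (𝕜 V)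

/-- The space `Hom^c_V(k,l)` of continuous linear maps `V^{⊗̂ k} → V^{⊗̂ l}`. -/
abbrev HomC (k l : ℕ) : Type _ := CompletedPow 𝕜 V k →L[𝕜] CompletedPow 𝕜 V l

end Power

end

/-! A continuous linear map from a completed tensor power to a Hausdorff space is determined by its
values on pure tensors, since these span a dense subspace. Once `hcomp` is known to send `a ⊗ b` to
`f a ⊗ g b` (`HomC.hcomp_mul`), each ProP axiom that is not plain associativity of composition
reduces to an identity about concatenating and permuting finite families of vectors.

The analytic content is the isomorphism `V^{⊗̂ k} ⊗̂ V^{⊗̂ l} ≃ V^{⊗̂ (k + l)}`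
(`CompletedPow.exists_mulEquiv`). From right to left it comes from the universal property of the
projective topology, applied to the map that splits a family of `k + l` vectors into two tensors.
From left to right, concatenation must be jointly continuous, so that it extends to the completions.
A continuous multilinear map is bounded by `C * ∏ p (x i)` for one continuous seminorm `p`
(`MultilinearMap.exists_seminorm_bound`), and projective seminorms turn this into `r (z ⊗ w) ≤ C *
π_k z * π_l w` (`TensorPow.continuous_mulₗ`). The universal properties apply to completed targets
because the completion of a locally convex space is again locally convex. -/

noncomputable section

open Filter Topology

/-! ### Spaces carrying a single seminorm -/

section Seminormed

variable {𝕜 : Type*} [RCLike 𝕜] {E : Type*} [AddCommGroup E] [Module 𝕜 E]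

/-- The space `E` with the topology of the seminorm `p`. -/
def SeminormSpace (_p : Seminorm 𝕜 E) : Type _ := E

namespace SeminormSpace

variable (p : Seminorm 𝕜 E)

instance : SeminormedAddCommGroup (SeminormSpace p) :=
  p.toAddGroupSeminorm.toSeminormedAddCommGroup

instance : Module 𝕜 (SeminormSpace p) := inferInstanceAs (Module 𝕜 E)

instance : NormedSpace 𝕜 (SeminormSpace p) where
  norm_smul_le a x := (map_smul_eq_mul p a x).le

/-- The identity `E → (E, p)`. -/
def mk : E →ₗ[𝕜] SeminormSpace p := LinearMap.id

/-- The identity `(E, p) → E`. -/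
def out : SeminormSpace p →ₗ[𝕜] E := LinearMap.id

@[simp] theorem norm_mk (x : E) : ‖mk p x‖ = p x := rfl

theorem continuous_mk [TopologicalSpace E] [IsTopologicalAddGroup E] (hp : Continuous p) :
    Continuous (mk p) := by
  refine continuous_of_continuousAt_zero (mk p) ?_
  rw [ContinuousAt, map_zero, tendsto_zero_iff_norm_tendsto_zero]
  simpa using hp.tendsto 0

end SeminormSpace

end Seminormed

/-! ### Bounds for continuous multilinear maps -/

section Bounds

variable {𝕜 : Type*} [RCLike 𝕜]

/-- A basic neighbourhood of zero is a ball of some radius `r` for a finite supremum of continuous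
seminorms; that supremum is continuous, and scaling it by `r⁻¹` makes the radius one. -/
theorem exists_seminorm_lt_one {E : Type*} [AddCommGroup E] [Module 𝕜 E] [TopologicalSpace E]
    [PolynormableSpace 𝕜 E] {U : Set E} (hU : U ∈ 𝓝 0) :
    ∃ p : Seminorm 𝕜 E, Continuous p ∧ ∀ x, p x < 1 → x ∈ U := by
  have hE := PolynormableSpace.withSeminorms 𝕜 E
  obtain ⟨s, r, hr, h⟩ := (hE.mem_nhds_iff 0 U).1 hU
  have := hE.topologicalAddGroup
  have := hE.continuousSMul
  lift r to NNReal using hr.le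
  let q : Seminorm 𝕜 E := s.sup fun p : {p : Seminorm 𝕜 E // Continuous p} => p.1
  have hq : Continuous q := Seminorm.continuous_finsetSup fun i _ => i.2
  refine ⟨r⁻¹ • q, hq.const_smul r⁻¹, fun x hx => h ((Seminorm.mem_ball_zero _).2 ?_)⟩
  have hx' : (r : ℝ)⁻¹ * q x < 1 := hx
  rwa [inv_mul_lt_iff₀ (show (0 : ℝ) < r from hr), mul_one] at hx'

/-- A continuous multilinear map is bounded by products of a continuous seminorm. -/
theorem MultilinearMap.exists_seminorm_bound {ι V G : Type*} [Fintype ι]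
    [AddCommGroup V] [Module 𝕜 V] [TopologicalSpace V] [PolynormableSpace 𝕜 V]
    [AddCommGroup G] [Module 𝕜 G] [TopologicalSpace G]
    (M : MultilinearMap 𝕜 (fun _ : ι => V) G) (hM : Continuous M)
    (r : Seminorm 𝕜 G) (hr : Continuous r) :
    ∃ (p : Seminorm 𝕜 V) (C : ℝ), Continuous p ∧ 0 ≤ C ∧ ∀ x, r (M x) ≤ C * ∏ i, p (x i) := by
  -- `M 0` need not vanish when `ι` is empty; the constant `r (M 0) + 1` covers that case too.
  have h0 : {x : ι → V | r (M x) < r (M 0) + 1} ∈ 𝓝 0 :=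
    (isOpen_lt (hr.comp hM) continuous_const).mem_nhds (by simp)
  rw [nhds_pi, Filter.mem_pi'] at h0
  obtain ⟨I, t, ht, hsub⟩ := h0
  -- Only the finitely many coordinates in `I` are constrained, so a single seminorm serves for all
  -- of them.
  obtain ⟨p, hp, hp1⟩ := exists_seminorm_lt_one (𝕜 := 𝕜)
    ((Filter.biInter_finset_mem I).2 fun i _ => ht i)
  have hC : 0 ≤ r (M 0) + 1 := by positivity
  refine ⟨p, r (M 0) + 1, hp, hC, fun x => ?_⟩
  -- Dividing `x i` by `p (x i) + ε` moves it into the open unit ball of `p`. The `ε` allows for `p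
  -- (x i) = 0` and tends to zero at the end.
  have key : ∀ ε : ℝ, 0 < ε → r (M x) ≤ (r (M 0) + 1) * ∏ i, (p (x i) + ε) := by
    intro ε hε
    have hpos : ∀ i, 0 < p (x i) + ε := fun i => by positivity
    have hx : x = fun i => ((p (x i) + ε : ℝ) : 𝕜) • (((p (x i) + ε : ℝ) : 𝕜)⁻¹ • x i) := by
      funext i
      rw [smul_inv_smul₀]
      exact_mod_cast (hpos i).ne'
    have hlt : r (M fun i => ((p (x i) + ε : ℝ) : 𝕜)⁻¹ • x i) ≤ r (M 0) + 1 := by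
      refine le_of_lt (hsub ?_)
      intro i hi
      have := hp1 (((p (x i) + ε : ℝ) : 𝕜)⁻¹ • x i) (by
        rw [map_smul_eq_mul, norm_inv, RCLike.norm_ofReal, abs_of_pos (hpos i),
          inv_mul_lt_iff₀ (hpos i)]
        linarith)
      exact Set.mem_iInter₂.1 this i hi
    calc r (M x) = r (M fun i =>
            ((p (x i) + ε : ℝ) : 𝕜) • (((p (x i) + ε : ℝ) : 𝕜)⁻¹ • x i)) := by rw [← hx]
      _ = r (M fun i => ((p (x i) + ε : ℝ) : 𝕜)⁻¹ • x i) * ∏ i, (p (x i) + ε) := by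
          rw [M.map_smul_univ, map_smul_eq_mul, mul_comm, norm_prod]
          congr 1
          exact Finset.prod_congr rfl fun i _ => by
            rw [RCLike.norm_ofReal, abs_of_pos (hpos i)]
      _ ≤ _ := mul_le_mul_of_nonneg_right hlt (Finset.prod_nonneg fun i _ => (hpos i).le)
  have hlim : Tendsto (fun ε : ℝ => (r (M 0) + 1) * ∏ i, (p (x i) + ε)) (𝓝[>] 0)
      (𝓝 ((r (M 0) + 1) * ∏ i, (p (x i) + 0))) :=
    ((by fun_prop : Continuous fun ε : ℝ =>
      (r (M 0) + 1) * ∏ i, (p (x i) + ε)).tendsto 0).mono_left nhdsWithin_le_nhds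
  simpa using ge_of_tendsto hlim (eventually_mem_nhdsWithin.mono fun ε hε => key ε hε)

end Bounds

/-! ### Completions of locally convex spaces -/

section Completion

variable {𝕜 : Type*} [RCLike 𝕜] {E : Type*} [AddCommGroup E] [Module 𝕜 E] [UniformSpace E]
  [IsUniformAddGroup E] [UniformContinuousConstSMul 𝕜 E]

open UniformSpace

/-- The extension of a continuous seminorm to the completion. -/
def Seminorm.completion (p : Seminorm 𝕜 E) (hp : Continuous p) : Seminorm 𝕜 (Completion E) :=
  have hu : UniformContinuous p :=
    Seminorm.uniformContinuous_of_continuousAt_zero hp.continuousAt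
  Seminorm.of (Completion.extension p)
    (fun x y => by
      induction x, y using Completion.induction_on₂ with
      | hp =>
        exact isClosed_le (Completion.continuous_extension.comp continuous_add)
          ((Completion.continuous_extension.comp continuous_fst).add
            (Completion.continuous_extension.comp continuous_snd))
      | ih x y =>
        rw [← Completion.coe_add, Completion.extension_coe hu, Completion.extension_coe hu,
          Completion.extension_coe hu]
        exact map_add_le_add p x y)
    (fun a x => by
      induction x using Completion.induction_on with
      | hp =>
        exact isClosed_eq (Completion.continuous_extension.comp (continuous_const_smul a))
          (Completion.continuous_extension.const_mul _)
      | ih x =>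
        rw [← Completion.coe_smul, Completion.extension_coe hu, Completion.extension_coe hu]
        exact map_smul_eq_mul p a x)

theorem Seminorm.continuous_completion (p : Seminorm 𝕜 E) (hp : Continuous p) :
    Continuous (p.completion hp) :=
  Completion.continuous_extension

theorem Seminorm.completion_coe (p : Seminorm 𝕜 E) (hp : Continuous p) (x : E) :
    p.completion hp (x : Completion E) = p x :=
  Completion.extension_coe (Seminorm.uniformContinuous_of_continuousAt_zero hp.continuousAt) x

/-- The extensions of the continuous seminorms of `E` define the topology: by regularity it suffices
to fit a unit ball into closed neighbourhoods, and there density reduces the inclusion to points of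
`E`. -/
instance [PolynormableSpace 𝕜 E] : PolynormableSpace 𝕜 (Completion E) := by
  let P : SeminormFamily 𝕜 (Completion E) {p : Seminorm 𝕜 E // Continuous p} :=
    fun p => p.1.completion p.2
  refine WithSeminorms.toPolynormableSpace (p := P)
    ((SeminormFamily.withSeminorms_iff_nhds_eq_iInf P).2 (le_antisymm ?_ ?_))
  · refine le_iInf fun p => ?_
    rw [← tendsto_iff_comap, ← map_zero (P p)]
    exact (p.1.continuous_completion p.2).tendsto 0
  · intro U hU
    obtain ⟨C, hC, hCc, hCU⟩ := exists_mem_nhds_isClosed_subset hU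
    obtain ⟨p, hp, hpC⟩ := exists_seminorm_lt_one (𝕜 := 𝕜)
      ((Completion.continuous_coe E).tendsto' 0 0 Completion.coe_zero hC)
    have hO : IsOpen {x : Completion E | p.completion hp x < 1} :=
      isOpen_lt (p.continuous_completion hp) continuous_const
    -- An open set lies in the closure of its trace on the dense subspace `E`; this trace lies in
    -- the closed set `C`.
    have hsub : {x : Completion E | p.completion hp x < 1} ⊆ U := by
      refine (Completion.denseRange_coe.open_subset_closure_inter hO).trans
        ((closure_minimal ?_ hCc).trans hCU)
      rintro _ ⟨hx, x, rfl⟩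
      refine hpC x ?_
      rwa [Set.mem_ofPred_eq, p.completion_coe hp] at hx
    refine mem_iInf_of_mem ⟨p, hp⟩ (mem_of_superset ?_ hsub)
    rw [mem_comap]
    exact ⟨Set.Iio 1, Iio_mem_nhds one_pos, subset_rfl⟩

instance [PolynormableSpace 𝕜 E] : ContinuousSMul 𝕜 (Completion E) :=
  (PolynormableSpace.withSeminorms 𝕜 (Completion E)).continuousSMul

end Completion

/-! ### Extension of bilinear maps to completions -/

section Bilinear

open UniformSpace

variable {𝕜 : Type*} [RCLike 𝕜] {E F G : Type*}
  [AddCommGroup E] [Module 𝕜 E] [UniformSpace E] [IsUniformAddGroup E]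
  [UniformContinuousConstSMul 𝕜 E]
  [AddCommGroup F] [Module 𝕜 F] [UniformSpace F] [IsUniformAddGroup F]
  [UniformContinuousConstSMul 𝕜 F]
  [AddCommGroup G] [Module 𝕜 G] [UniformSpace G] [IsUniformAddGroup G]
  [UniformContinuousConstSMul 𝕜 G]

/-- A continuous bilinear map with values in a complete Hausdorff space extends to the
completions. -/
theorem LinearMap.exists_completion_extension₂ [T2Space G] [CompleteSpace G]
    (B : E →ₗ[𝕜] F →ₗ[𝕜] G) (hB : Continuous fun x : E × F => B x.1 x.2) :
    ∃ B' : Completion E →ₗ[𝕜] Completion F →ₗ[𝕜] G,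
      (Continuous fun x : Completion E × Completion F => B' x.1 x.2) ∧
      ∀ (x : E) (y : F), B' x y = B x y := by
  -- The extension theorem concerns biadditive maps of topological groups; bilinearity of the
  -- extension is then recovered by density.
  let φ : E →+ F →+ G :=
    AddMonoidHom.mk' (fun x => (B x).toAddMonoidHom) fun x y => by ext z; simp
  have di : IsDenseInducing (Completion.toCompl : E →+ Completion E) :=
    Completion.isDenseInducing_coe
  have df : IsDenseInducing (Completion.toCompl : F →+ Completion F) :=
    Completion.isDenseInducing_coe
  have hφ : Continuous fun x : E × F => φ x.1 x.2 := hB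
  obtain ⟨b, hb, hbB⟩ : ∃ b : Completion E × Completion F → G, Continuous b ∧
      ∀ (x : E) (y : F), b (x, y) = B x y :=
    ⟨_, di.extend_Z_bilin df hφ, fun x y => (di.prodMap df).extend_eq hφ (x, y)⟩
  refine ⟨LinearMap.mk₂ 𝕜 (fun x y => b (x, y)) ?_ ?_ ?_ ?_, hb, hbB⟩
  · intro x x' y
    induction x, x', y using Completion.induction_on₃ with
    | hp => exact isClosed_eq (by fun_prop) (by fun_prop)
    | ih x x' y => rw [← Completion.coe_add, hbB, hbB, hbB, map_add, LinearMap.add_apply]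
  · intro c x y
    induction x, y using Completion.induction_on₂ with
    | hp =>
      exact isClosed_eq (hb.comp ((continuous_fst.const_smul c).prodMk continuous_snd))
        ((hb.comp (continuous_fst.prodMk continuous_snd)).const_smul c)
    | ih x y => rw [← Completion.coe_smul, hbB, hbB, map_smul, LinearMap.smul_apply]
  · intro x y y'
    induction x, y, y' using Completion.induction_on₃ with
    | hp => exact isClosed_eq (by fun_prop) (by fun_prop)
    | ih x y y' => rw [← Completion.coe_add, hbB, hbB, hbB, map_add]
  · intro c x y
    induction x, y using Completion.induction_on₂ with
    | hp =>
      exact isClosed_eq (hb.comp (continuous_fst.prodMk (continuous_snd.const_smul c)))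
        ((hb.comp (continuous_fst.prodMk continuous_snd)).const_smul c)
    | ih x y => rw [← Completion.coe_smul, hbB, hbB, map_smul]

/-- The inclusion of a space in its completion. -/
def toComplCLM : G →L[𝕜] Completion G where
  toFun x := x
  map_add' := Completion.coe_add
  map_smul' := Completion.coe_smul
  cont := Completion.continuous_coe G

end Bilinear

/-! ### Completed tensor products -/

section Tensor

open UniformSpace

variable {𝕜 : Type*} [RCLike 𝕜] {E F : Type*}
  [AddCommGroup E] [Module 𝕜 E] [AddCommGroup F] [Module 𝕜 F]

theorem ProjTensor.hom_ext {G : Type*} [AddCommGroup G] [Module 𝕜 G]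
    {f g : ProjTensor 𝕜 E F →ₗ[𝕜] G}
    (h : ∀ x y, f (ProjTensor.mk 𝕜 E F x y) = g (ProjTensor.mk 𝕜 E F x y)) : f = g :=
  TensorProduct.ext' h

variable [TopologicalSpace E] [TopologicalSpace F]

theorem CompletedTensor.hom_ext {G : Type*} [AddCommGroup G] [Module 𝕜 G] [TopologicalSpace G]
    [T2Space G] {f g : CompletedTensor 𝕜 E F →L[𝕜] G}
    (h : ∀ x y, f (CompletedTensor.tmul 𝕜 x y) = g (CompletedTensor.tmul 𝕜 x y)) : f = g := by
  ext z
  induction z using Completion.induction_on with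
  | hp => exact isClosed_eq f.continuous g.continuous
  | ih z =>
    exact LinearMap.congr_fun (ProjTensor.hom_ext
      (f := (f.comp toComplCLM).toLinearMap) (g := (g.comp toComplCLM).toLinearMap) h) z

theorem CompletedTensor.continuous_tmul :
    Continuous fun x : E × F => CompletedTensor.tmul 𝕜 x.1 x.2 :=
  (Completion.continuous_coe _).comp ProjTensor.continuous_tmul

/-- The continuous linear map on `E ⊗̂ F` that corresponds to a continuous bilinear map. -/
def CompletedTensor.lift {G : Type*} [AddCommGroup G] [Module 𝕜 G] [UniformSpace G]
    [IsUniformAddGroup G] [ContinuousSMul 𝕜 G] [PolynormableSpace 𝕜 G] [T2Space G]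
    [CompleteSpace G] (B : E →ₗ[𝕜] F →ₗ[𝕜] G) (hB : Continuous fun x : E × F => B x.1 x.2) :
    CompletedTensor 𝕜 E F →L[𝕜] G :=
  have : UniformContinuousConstSMul 𝕜 G := uniformContinuousConstSMul_of_continuousConstSMul 𝕜 G
  ContinuousLinearMap.fromCompletion
    { toLinearMap := (TensorProduct.lift B : E ⊗[𝕜] F →ₗ[𝕜] G)
      cont := ProjTensor.continuous_of_tmul (TensorProduct.lift B : E ⊗[𝕜] F →ₗ[𝕜] G) hB }

theorem CompletedTensor.lift_tmul {G : Type*} [AddCommGroup G] [Module 𝕜 G] [UniformSpace G]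
    [IsUniformAddGroup G] [ContinuousSMul 𝕜 G] [PolynormableSpace 𝕜 G] [T2Space G]
    [CompleteSpace G] (B : E →ₗ[𝕜] F →ₗ[𝕜] G) (hB : Continuous fun x : E × F => B x.1 x.2)
    (x : E) (y : F) : CompletedTensor.lift B hB (CompletedTensor.tmul 𝕜 x y) = B x y := by
  have : UniformContinuousConstSMul 𝕜 G := uniformContinuousConstSMul_of_continuousConstSMul 𝕜 G
  exact ContinuousLinearMap.fromCompletion_apply_coe _ _

end Tensor

/-! ### Completed tensor powers -/

section Power

open UniformSpace

variable {𝕜 : Type v} [RCLike 𝕜] {V : Type u} [AddCommGroup V] [Module 𝕜 V]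

/-- The linear map on `V^{⊗ n}` that corresponds to a multilinear map. -/
def TensorPow.lift {n : ℕ} {G : Type*} [AddCommGroup G] [Module 𝕜 G]
    (M : MultilinearMap 𝕜 (fun _ : Fin n => V) G) : TensorPow 𝕜 V n →ₗ[𝕜] G :=
  PiTensorProduct.lift M

@[simp] theorem TensorPow.lift_tprod {n : ℕ} {G : Type*} [AddCommGroup G] [Module 𝕜 G]
    (M : MultilinearMap 𝕜 (fun _ : Fin n => V) G) (x : Fin n → V) :
    TensorPow.lift M (TensorPow.tprod 𝕜 V n x) = M x :=
  PiTensorProduct.lift.tprod x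

theorem TensorPow.hom_ext {n : ℕ} {G : Type*} [AddCommGroup G] [Module 𝕜 G]
    {f g : TensorPow 𝕜 V n →ₗ[𝕜] G}
    (h : ∀ x, f (TensorPow.tprod 𝕜 V n x) = g (TensorPow.tprod 𝕜 V n x)) : f = g :=
  PiTensorProduct.ext (MultilinearMap.ext h)

/-- The projective seminorm on `V^{⊗ n}` of a seminorm on `V`. -/
def TensorPow.projSeminorm (n : ℕ) (p : Seminorm 𝕜 V) : Seminorm 𝕜 (TensorPow 𝕜 V n) :=
  (normSeminorm 𝕜 (⨂[𝕜] _ : Fin n, SeminormSpace p)).comp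
    (TensorPow.lift ((PiTensorProduct.tprod 𝕜).compLinearMap fun _ => SeminormSpace.mk p))

/-- The projective seminorm dominates every seminorm with the same bound on pure tensors: `T` gives
a bounded multilinear map from copies of `(V, p)` to `(G, r)`, whose linearization has norm at most
`C`. -/
theorem TensorPow.le_projSeminorm {n : ℕ} {p : Seminorm 𝕜 V} {G : Type*} [AddCommGroup G]
    [Module 𝕜 G] (T : TensorPow 𝕜 V n →ₗ[𝕜] G) (r : Seminorm 𝕜 G) {C : ℝ} (hC : 0 ≤ C)
    (h : ∀ x, r (T (TensorPow.tprod 𝕜 V n x)) ≤ C * ∏ i, p (x i)) (z : TensorPow 𝕜 V n) :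
    r (T z) ≤ C * TensorPow.projSeminorm n p z := by
  let M : MultilinearMap 𝕜 (fun _ : Fin n => SeminormSpace p) (SeminormSpace r) :=
    (SeminormSpace.mk r ∘ₗ T).compMultilinearMap
      ((TensorPow.tprod 𝕜 V n).compLinearMap fun _ => SeminormSpace.out p)
  let L : TensorPow 𝕜 V n →ₗ[𝕜] ⨂[𝕜] _ : Fin n, SeminormSpace p :=
    TensorPow.lift ((PiTensorProduct.tprod 𝕜).compLinearMap fun _ => SeminormSpace.mk p)
  let f := M.mkContinuous C fun x => h fun i => SeminormSpace.out p (x i)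
  have hf : PiTensorProduct.lift f.toMultilinearMap ∘ₗ L = SeminormSpace.mk r ∘ₗ T := by
    refine TensorPow.hom_ext fun x => ?_
    simp only [L, LinearMap.comp_apply, TensorPow.lift_tprod]
    exact PiTensorProduct.lift.tprod _
  have key := PiTensorProduct.norm_eval_le_projectiveSeminorm f (L z)
  rw [← LinearMap.comp_apply, hf] at key
  exact key.trans (mul_le_mul_of_nonneg_right (M.mkContinuous_norm_le hC _) (norm_nonneg _))

/-- The concatenation `V^{⊗ k} × V^{⊗ l} → V^{⊗ (k + l)}`. -/
def TensorPow.mulₗ (k l : ℕ) :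
    TensorPow 𝕜 V k →ₗ[𝕜] TensorPow 𝕜 V l →ₗ[𝕜] TensorPow 𝕜 V (k + l) :=
  TensorProduct.curry
    (TensorPower.mulEquiv.toLinearMap : ⨂[𝕜]^k V ⊗[𝕜] (⨂[𝕜]^l) V →ₗ[𝕜] (⨂[𝕜]^(k + l)) V)

theorem TensorPow.mulₗ_tprod {k l : ℕ} (x : Fin k → V) (y : Fin l → V) :
    TensorPow.mulₗ k l (TensorPow.tprod 𝕜 V k x) (TensorPow.tprod 𝕜 V l y) =
      TensorPow.tprod 𝕜 V (k + l) (Fin.append x y) :=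
  TensorPower.tprod_mul_tprod 𝕜 x y

variable [TopologicalSpace V]

/-- It is the norm composed with a linear map into a seminormed tensor power, and that map is
continuous by the universal property of the projective topology. -/
theorem TensorPow.continuous_projSeminorm [IsTopologicalAddGroup V] {n : ℕ} {p : Seminorm 𝕜 V}
    (hp : Continuous p) : Continuous (TensorPow.projSeminorm n p) := by
  refine continuous_norm.comp (TensorPow.continuous_of_tprod (TensorPow.lift
    ((PiTensorProduct.tprod 𝕜).compLinearMap fun _ => SeminormSpace.mk p)) ?_)
  simp only [TensorPow.lift_tprod]
  exact (PiTensorProduct.tprodL 𝕜).cont.comp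
    (continuous_pi fun i => (SeminormSpace.continuous_mk p hp).comp (continuous_apply i))

theorem TensorPow.continuous_mulₗ [IsTopologicalAddGroup V] [PolynormableSpace 𝕜 V] (k l : ℕ) :
    Continuous fun z : TensorPow 𝕜 V k × TensorPow 𝕜 V l => TensorPow.mulₗ k l z.1 z.2 := by
  refine continuous_iff_continuousAt.2 fun ⟨z₀, w₀⟩ => ?_
  refine ((PolynormableSpace.withSeminorms 𝕜 (TensorPow 𝕜 V (k + l))).tendsto_nhds _ _).2 ?_
  rintro ⟨r, hr⟩ ε hε
  obtain ⟨p, C, hp, hC, hM⟩ := (TensorPow.tprod 𝕜 V (k + l)).exists_seminorm_bound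
    (TensorPow.continuous_tprod 𝕜) r hr
  -- The bound on pure tensors is extended to arbitrary tensors one variable at a time, first with
  -- `w` pure and then in general. Using the same `p` for both factors is possible because the
  -- product over `k + l` indices splits.
  have key : ∀ z w, r (TensorPow.mulₗ k l z w) ≤
      C * TensorPow.projSeminorm k p z * TensorPow.projSeminorm l p w := by
    intro z w
    refine TensorPow.le_projSeminorm (TensorPow.mulₗ k l z) r
      (mul_nonneg hC (apply_nonneg _ _)) (fun y => ?_) w
    rw [mul_right_comm]
    refine TensorPow.le_projSeminorm ((TensorPow.mulₗ k l).flip (TensorPow.tprod 𝕜 V l y)) r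
      (mul_nonneg hC (Finset.prod_nonneg fun i _ => apply_nonneg _ _)) (fun x => ?_) z
    rw [LinearMap.flip_apply, TensorPow.mulₗ_tprod]
    refine (hM _).trans (le_of_eq ?_)
    rw [Fin.prod_univ_add]
    simp only [Fin.append_left, Fin.append_right]
    ring
  have hk := TensorPow.continuous_projSeminorm (n := k) hp
  have hl := TensorPow.continuous_projSeminorm (n := l) hp
  -- This function bounds the two terms of `z ⊗ w - z₀ ⊗ w₀ = (z - z₀) ⊗ w + z₀ ⊗ (w - w₀)` and
  -- vanishes at `(z₀, w₀)`.
  have hc : Continuous fun z : TensorPow 𝕜 V k × TensorPow 𝕜 V l =>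
      C * TensorPow.projSeminorm k p (z.1 - z₀) * TensorPow.projSeminorm l p z.2 +
      C * TensorPow.projSeminorm k p z₀ * TensorPow.projSeminorm l p (z.2 - w₀) := by
    fun_prop
  filter_upwards [hc.continuousAt.eventually_lt
    (continuousAt_const (x := (z₀, w₀)) (y := ε)) (by simpa using hε)] with z hz
  refine lt_of_le_of_lt ?_ hz
  have : TensorPow.mulₗ k l z.1 z.2 - TensorPow.mulₗ k l z₀ w₀ =
      TensorPow.mulₗ k l (z.1 - z₀) z.2 + TensorPow.mulₗ k l z₀ (z.2 - w₀) := by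
    simp only [map_sub, LinearMap.sub_apply]
    abel
  rw [this]
  exact (map_add_le_add r _ _).trans (add_le_add (key _ _) (key _ _))

/-- Pure tensors span the algebraic power, which is dense in the completion. -/
theorem CompletedPow.hom_ext {n : ℕ} {G : Type*} [AddCommGroup G] [Module 𝕜 G]
    [TopologicalSpace G] [T2Space G] {f g : CompletedPow 𝕜 V n →L[𝕜] G}
    (h : ∀ x, f (CompletedPow.tprod 𝕜 x) = g (CompletedPow.tprod 𝕜 x)) : f = g := by
  ext z
  induction z using Completion.induction_on with
  | hp => exact isClosed_eq f.continuous g.continuous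
  | ih z =>
    exact LinearMap.congr_fun (TensorPow.hom_ext
      (f := (f.comp toComplCLM).toLinearMap) (g := (g.comp toComplCLM).toLinearMap) h) z

theorem CompletedPow.continuous_tprod {n : ℕ} :
    Continuous fun x : Fin n → V => CompletedPow.tprod 𝕜 x :=
  (Completion.continuous_coe _).comp (TensorPow.continuous_tprod 𝕜)

/-- The continuous linear map on `V^{⊗̂ n}` that corresponds to a continuous multilinear map. -/
def CompletedPow.lift {n : ℕ} {G : Type*} [AddCommGroup G] [Module 𝕜 G] [UniformSpace G]
    [IsUniformAddGroup G] [ContinuousSMul 𝕜 G] [PolynormableSpace 𝕜 G] [T2Space G]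
    [CompleteSpace G] (M : MultilinearMap 𝕜 (fun _ : Fin n => V) G) (hM : Continuous M) :
    CompletedPow 𝕜 V n →L[𝕜] G :=
  have : UniformContinuousConstSMul 𝕜 G := uniformContinuousConstSMul_of_continuousConstSMul 𝕜 G
  ContinuousLinearMap.fromCompletion
    { toLinearMap := TensorPow.lift M
      cont := TensorPow.continuous_of_tprod _ (by simpa using hM) }

theorem CompletedPow.lift_tprod {n : ℕ} {G : Type*} [AddCommGroup G] [Module 𝕜 G]
    [UniformSpace G] [IsUniformAddGroup G] [ContinuousSMul 𝕜 G] [PolynormableSpace 𝕜 G]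
    [T2Space G] [CompleteSpace G] (M : MultilinearMap 𝕜 (fun _ : Fin n => V) G)
    (hM : Continuous M) (x : Fin n → V) :
    CompletedPow.lift M hM (CompletedPow.tprod 𝕜 x) = M x := by
  have : UniformContinuousConstSMul 𝕜 G := uniformContinuousConstSMul_of_continuousConstSMul 𝕜 G
  exact (ContinuousLinearMap.fromCompletion_apply_coe _ _).trans (TensorPow.lift_tprod M x)

theorem CompletedPow.exists_mul [IsTopologicalAddGroup V] [PolynormableSpace 𝕜 V] (k l : ℕ) :
    ∃ B : CompletedPow 𝕜 V k →ₗ[𝕜] CompletedPow 𝕜 V l →ₗ[𝕜] CompletedPow 𝕜 V (k + l),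
      (Continuous fun z : CompletedPow 𝕜 V k × CompletedPow 𝕜 V l => B z.1 z.2) ∧
      ∀ x y, B (CompletedPow.tprod 𝕜 x) (CompletedPow.tprod 𝕜 y) =
        CompletedPow.tprod 𝕜 (Fin.append x y) := by
  obtain ⟨B, hB, h⟩ := LinearMap.exists_completion_extension₂
    ((TensorPow.mulₗ (𝕜 := 𝕜) (V := V) k l).compr₂ (toComplCLM (𝕜 := 𝕜)).toLinearMap)
    ((Completion.continuous_coe _).comp (TensorPow.continuous_mulₗ k l))
  exact ⟨B, hB, fun x y => (h _ _).trans
    (congrArg (fun z : TensorPow 𝕜 V (k + l) => (z : CompletedPow 𝕜 V (k + l)))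
      (TensorPow.mulₗ_tprod x y))⟩

/-- The canonical isomorphism `V^{⊗̂ k} ⊗̂ V^{⊗̂ l} = V^{⊗̂ (k + l)}`. -/
theorem CompletedPow.exists_mulEquiv [IsTopologicalAddGroup V] [PolynormableSpace 𝕜 V]
    (k l : ℕ) :
    ∃ μ : CompletedTensor 𝕜 (CompletedPow 𝕜 V k) (CompletedPow 𝕜 V l) ≃L[𝕜]
        CompletedPow 𝕜 V (k + l), ∀ x y,
      μ (CompletedTensor.tmul 𝕜 (CompletedPow.tprod 𝕜 x) (CompletedPow.tprod 𝕜 y)) =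
        CompletedPow.tprod 𝕜 (Fin.append x y) := by
  obtain ⟨B, hB, hBt⟩ := CompletedPow.exists_mul (𝕜 := 𝕜) (V := V) k l
  let μ := CompletedTensor.lift B hB
  have hμ : ∀ x y, μ (CompletedTensor.tmul 𝕜 x y) = B x y := CompletedTensor.lift_tmul B hB
  let T : TensorPow 𝕜 V k →ₗ[𝕜] TensorPow 𝕜 V l →ₗ[𝕜]
      CompletedTensor 𝕜 (CompletedPow 𝕜 V k) (CompletedPow 𝕜 V l) :=
    ((ProjTensor.mk 𝕜 _ _).compr₂ (toComplCLM (𝕜 := 𝕜)).toLinearMap).compl₁₂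
      (toComplCLM (𝕜 := 𝕜)).toLinearMap (toComplCLM (𝕜 := 𝕜)).toLinearMap
  -- Splitting a family into its first `k` and last `l` vectors. Defining it through the algebraic
  -- isomorphism gives multilinearity at once; the explicit formula `hM` then gives continuity.
  let M : MultilinearMap 𝕜 (fun _ : Fin (k + l) => V)
      (CompletedTensor 𝕜 (CompletedPow 𝕜 V k) (CompletedPow 𝕜 V l)) :=
    (TensorProduct.lift T ∘ₗ (TensorPower.mulEquiv.symm.toLinearMap :
      (⨂[𝕜]^(k + l)) V →ₗ[𝕜] ⨂[𝕜]^k V ⊗[𝕜] (⨂[𝕜]^l) V)).compMultilinearMap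
      (PiTensorProduct.tprod 𝕜)
  have hM' : ∀ (x : Fin k → V) (y : Fin l → V), M (Fin.append x y) =
      CompletedTensor.tmul 𝕜 (CompletedPow.tprod 𝕜 x) (CompletedPow.tprod 𝕜 y) := by
    intro x y
    change TensorProduct.lift T (TensorPower.mulEquiv.symm (PiTensorProduct.tprod 𝕜 _)) = _
    rw [← TensorPower.tprod_mul_tprod, TensorPower.gMul_def, LinearEquiv.symm_apply_apply]
    exact TensorProduct.lift.tmul _ _
  have hM : ∀ x, M x = CompletedTensor.tmul 𝕜
      (CompletedPow.tprod 𝕜 fun i => x (Fin.castAdd l i))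
      (CompletedPow.tprod 𝕜 fun i => x (Fin.natAdd k i)) := fun x => by
    rw [← hM', Fin.append_castAdd_natAdd]
  have hMc : Continuous M := by
    rw [show (M : (Fin (k + l) → V) → _) = _ from funext hM]
    exact CompletedTensor.continuous_tmul.comp
      ((CompletedPow.continuous_tprod.comp (by fun_prop)).prodMk
        (CompletedPow.continuous_tprod.comp (by fun_prop)))
  let ν := CompletedPow.lift M hMc
  have hν : ∀ x, ν (CompletedPow.tprod 𝕜 x) = M x := CompletedPow.lift_tprod M hMc
  have hμν : μ.comp ν = ContinuousLinearMap.id 𝕜 _ := CompletedPow.hom_ext fun x => by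
    rw [ContinuousLinearMap.comp_apply, hν, hM, hμ, hBt, Fin.append_castAdd_natAdd]
    rfl
  -- Testing `ν ∘ μ` on `E ⊗̂ F` involves `x ⊗ y` for all `x`, `y` in the completed powers. Joint
  -- continuity of `B` and of `⊗` reduces this to the algebraic powers, and bilinearity to pure
  -- tensors.
  have hνμ : ∀ x y, ν (B x y) = CompletedTensor.tmul 𝕜 x y := by
    intro x y
    induction x, y using Completion.induction_on₂ with
    | hp => exact isClosed_eq (ν.continuous.comp hB) CompletedTensor.continuous_tmul
    | ih x y =>
      let R : TensorPow 𝕜 V k →ₗ[𝕜] TensorPow 𝕜 V l →ₗ[𝕜]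
          CompletedTensor 𝕜 (CompletedPow 𝕜 V k) (CompletedPow 𝕜 V l) :=
        (B.compr₂ ν.toLinearMap).compl₁₂
          (toComplCLM (𝕜 := 𝕜)).toLinearMap (toComplCLM (𝕜 := 𝕜)).toLinearMap
      have hRT : R = T := TensorPow.hom_ext fun x => TensorPow.hom_ext fun y => by
        change ν (B (CompletedPow.tprod 𝕜 x) (CompletedPow.tprod 𝕜 y)) = _
        rw [hBt, hν, hM']
        rfl
      exact LinearMap.congr_fun₂ hRT x y
  have hνμ' : ν.comp μ = ContinuousLinearMap.id 𝕜 _ := CompletedTensor.hom_ext fun x y => by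
    rw [ContinuousLinearMap.comp_apply, hμ, hνμ]
    rfl
  exact ⟨ContinuousLinearEquiv.equivOfInverse μ ν (DFunLike.congr_fun hνμ')
    (DFunLike.congr_fun hμν), fun x y => (hμ _ _).trans (hBt x y)⟩

end Power

/-! ### The ProP of continuous linear maps -/

section TensorLinearity

variable {𝕜 : Type*} [RCLike 𝕜] {E F E' F' : Type*}
  [AddCommGroup E] [Module 𝕜 E] [TopologicalSpace E]
  [AddCommGroup F] [Module 𝕜 F] [TopologicalSpace F]
  [AddCommGroup E'] [Module 𝕜 E'] [TopologicalSpace E']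
  [AddCommGroup F'] [Module 𝕜 F'] [TopologicalSpace F']

namespace CompletedTensor

variable (F) in
/-- The map `x ↦ x ⊗ y`. -/
def tmulRight (y : F) : E →L[𝕜] CompletedTensor 𝕜 E F where
  toLinearMap := (toComplCLM (𝕜 := 𝕜)).toLinearMap ∘ₗ (ProjTensor.mk 𝕜 E F).flip y
  cont := continuous_tmul.comp (continuous_id.prodMk continuous_const)

variable (F) in
/-- The map `y ↦ x ⊗ y`. -/
def tmulLeft (x : E) : F →L[𝕜] CompletedTensor 𝕜 E F where
  toLinearMap := (toComplCLM (𝕜 := 𝕜)).toLinearMap ∘ₗ ProjTensor.mk 𝕜 E F x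
  cont := continuous_tmul.comp (continuous_const.prodMk continuous_id)

theorem add_tmul (x x' : E) (y : F) : tmul 𝕜 (x + x') y = tmul 𝕜 x y + tmul 𝕜 x' y :=
  map_add (tmulRight F y) x x'

theorem smul_tmul (c : 𝕜) (x : E) (y : F) : tmul 𝕜 (c • x) y = c • tmul 𝕜 x y :=
  map_smul (tmulRight F y) c x

theorem tmul_add (x : E) (y y' : F) : tmul 𝕜 x (y + y') = tmul 𝕜 x y + tmul 𝕜 x y' :=
  map_add (tmulLeft F x) y y'

theorem tmul_smul (c : 𝕜) (x : E) (y : F) : tmul 𝕜 x (c • y) = c • tmul 𝕜 x y :=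
  map_smul (tmulLeft F x) c y

theorem map_add_left [IsTopologicalAddGroup E'] (f f' : E →L[𝕜] E') (g : F →L[𝕜] F') :
    map (f + f') g = map f g + map f' g :=
  hom_ext fun x y => by
    simp only [add_apply, map_tmul, add_tmul]

theorem map_smul_left [ContinuousConstSMul 𝕜 E'] (c : 𝕜) (f : E →L[𝕜] E') (g : F →L[𝕜] F') :
    map (c • f) g = c • map f g :=
  hom_ext fun x y => by
    simp only [smul_apply, map_tmul, smul_tmul]

theorem map_add_right [IsTopologicalAddGroup F'] (f : E →L[𝕜] E') (g g' : F →L[𝕜] F') :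
    map f (g + g') = map f g + map f g' :=
  hom_ext fun x y => by
    simp only [add_apply, map_tmul, tmul_add]

theorem map_smul_right [ContinuousConstSMul 𝕜 F'] (c : 𝕜) (f : E →L[𝕜] E') (g : F →L[𝕜] F') :
    map f (c • g) = c • map f g :=
  hom_ext fun x y => by
    simp only [smul_apply, map_tmul, tmul_smul]

end CompletedTensor

end TensorLinearity

/-! ### Index transport, permutations and concatenation on completed powers. -/

section HomC

variable {𝕜 : Type v} [RCLike 𝕜] {V : Type u} [AddCommGroup V] [Module 𝕜 V]
  [TopologicalSpace V]

/-- Transport along an equality of exponents. -/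
def CompletedPow.cast {m n : ℕ} (h : m = n) : CompletedPow 𝕜 V m →L[𝕜] CompletedPow 𝕜 V n :=
  h ▸ ContinuousLinearMap.id 𝕜 _

theorem CompletedPow.cast_tprod {m n : ℕ} (h : m = n) (x : Fin m → V) :
    CompletedPow.cast h (CompletedPow.tprod 𝕜 x) =
      CompletedPow.tprod 𝕜 fun i => x (Fin.cast h.symm i) := by
  subst h
  rfl

/-- Transporting a map along equalities of indices amounts to conjugating it by `cast`; this is how
`castIdx` is evaluated in the axioms. -/
theorem castIdx_apply_cast {k k' l l' : ℕ} (hk : k = k') (hl : l = l') (f : HomC 𝕜 V k l)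
    (z : CompletedPow 𝕜 V k) :
    (castIdx hk hl f : HomC 𝕜 V k' l') (CompletedPow.cast hk z) = CompletedPow.cast hl (f z) := by
  subst hk hl
  rfl

theorem blockPerm_castAdd {m n : ℕ} (σ : Equiv.Perm (Fin m)) (τ : Equiv.Perm (Fin n))
    (i : Fin m) : (blockPerm σ τ)⁻¹ (Fin.castAdd n i) = Fin.castAdd n (σ⁻¹ i) := by
  rw [Equiv.Perm.inv_eq_iff_eq]
  simp [blockPerm]

theorem blockPerm_natAdd {m n : ℕ} (σ : Equiv.Perm (Fin m)) (τ : Equiv.Perm (Fin n))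
    (i : Fin n) : (blockPerm σ τ)⁻¹ (Fin.natAdd m i) = Fin.natAdd m (τ⁻¹ i) := by
  rw [Equiv.Perm.inv_eq_iff_eq]
  simp [blockPerm]

theorem append_blockPerm_inv {α : Type*} {m n : ℕ} (σ : Equiv.Perm (Fin m))
    (τ : Equiv.Perm (Fin n)) (x : Fin m → α) (y : Fin n → α) :
    (fun i => Fin.append x y ((blockPerm σ τ)⁻¹ i)) =
      Fin.append (fun i => x (σ⁻¹ i)) (fun i => y (τ⁻¹ i)) := by
  funext i
  refine Fin.addCases (fun i => ?_) (fun i => ?_) i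
  · simp [blockPerm_castAdd]
  · simp [blockPerm_natAdd]

/-- The cast is needed because `Fin.append y x` is indexed by `Fin (n + m)`, while `blockSwap m n`
permutes `Fin (m + n)`. -/
theorem append_blockSwap_inv {α : Type*} {m n : ℕ} (x : Fin m → α) (y : Fin n → α) :
    (fun i => Fin.append x y ((blockSwap m n)⁻¹ i)) =
      fun i => Fin.append y x (Fin.cast (Nat.add_comm n m).symm i) := by
  funext i
  -- Writing `i` as the image of `j` cancels the inverse, so only the forward formula for the block
  -- transposition is used.
  obtain ⟨j, rfl⟩ := (blockSwap m n).surjective i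
  rw [Equiv.Perm.inv_def, Equiv.symm_apply_apply]
  refine Fin.addCases (fun j => ?_) (fun j => ?_) j <;> simp [blockSwap]

namespace CompletedPow

theorem theta_one {n : ℕ} :
    theta (1 : Equiv.Perm (Fin n)) = ContinuousLinearMap.id 𝕜 (CompletedPow 𝕜 V n) :=
  hom_ext fun x => by simp [theta_tprod]

/-- The inverse in `θ_σ` makes this a left action: `x (τ⁻¹ (σ⁻¹ i)) = x ((σ * τ)⁻¹ i)`. -/
theorem theta_comp_theta {n : ℕ} (σ τ : Equiv.Perm (Fin n)) :
    (theta σ).comp (theta τ) = (theta (σ * τ) : CompletedPow 𝕜 V n →L[𝕜] CompletedPow 𝕜 V n) :=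
  hom_ext fun x => by simp [theta_tprod]

variable [IsTopologicalAddGroup V] [PolynormableSpace 𝕜 V]

variable (𝕜 V) in
/-- The canonical isomorphism `V^{⊗̂ k} ⊗̂ V^{⊗̂ l} = V^{⊗̂ (k + l)}`. -/
def mulEquiv (k l : ℕ) :
    CompletedTensor 𝕜 (CompletedPow 𝕜 V k) (CompletedPow 𝕜 V l) ≃L[𝕜] CompletedPow 𝕜 V (k + l) :=
  (exists_mulEquiv k l).choose

/-- The concatenation `V^{⊗̂ k} × V^{⊗̂ l} → V^{⊗̂ (k + l)}`. -/
def mul {k l : ℕ} (a : CompletedPow 𝕜 V k) (b : CompletedPow 𝕜 V l) : CompletedPow 𝕜 V (k + l) :=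
  mulEquiv 𝕜 V k l (CompletedTensor.tmul 𝕜 a b)

theorem mul_tprod {k l : ℕ} (x : Fin k → V) (y : Fin l → V) :
    mul (tprod 𝕜 x) (tprod 𝕜 y) = tprod 𝕜 (Fin.append x y) :=
  (exists_mulEquiv k l).choose_spec x y

/-- The map `b ↦ a ⊗ b`. -/
def mulLeft {k : ℕ} (l : ℕ) (a : CompletedPow 𝕜 V k) :
    CompletedPow 𝕜 V l →L[𝕜] CompletedPow 𝕜 V (k + l) :=
  (mulEquiv 𝕜 V k l).toContinuousLinearMap.comp (CompletedTensor.tmulLeft _ a)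

@[simp] theorem mulLeft_apply {k l : ℕ} (a : CompletedPow 𝕜 V k) (b : CompletedPow 𝕜 V l) :
    mulLeft l a b = mul a b := rfl

/-- The map `a ↦ a ⊗ b`. -/
def mulRight (k : ℕ) {l : ℕ} (b : CompletedPow 𝕜 V l) :
    CompletedPow 𝕜 V k →L[𝕜] CompletedPow 𝕜 V (k + l) :=
  (mulEquiv 𝕜 V k l).toContinuousLinearMap.comp (CompletedTensor.tmulRight _ b)

@[simp] theorem mulRight_apply {k l : ℕ} (a : CompletedPow 𝕜 V k) (b : CompletedPow 𝕜 V l) :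
    mulRight k b a = mul a b := rfl

/-- Every pure tensor of length `k + l` is a concatenation. Testing on general `a` and `b` allows
the two factors to be treated as wholes, and the criterion to be iterated. -/
theorem hom_ext_mul {k l : ℕ} {G : Type*} [AddCommGroup G] [Module 𝕜 G]
    [TopologicalSpace G] [T2Space G] {f g : CompletedPow 𝕜 V (k + l) →L[𝕜] G}
    (h : ∀ (a : CompletedPow 𝕜 V k) (b : CompletedPow 𝕜 V l), f (mul a b) = g (mul a b)) :
    f = g :=
  hom_ext fun x => by
    rw [← Fin.append_castAdd_natAdd (f := x), ← mul_tprod]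
    exact h _ _

theorem theta_mul {k l : ℕ} (σ : Equiv.Perm (Fin k)) (τ : Equiv.Perm (Fin l))
    (a : CompletedPow 𝕜 V k) (b : CompletedPow 𝕜 V l) :
    theta (blockPerm σ τ) (mul a b) = mul (theta σ a) (theta τ b) := by
  -- Both sides are continuous and linear in each factor separately, so `a` and then `b` may be
  -- taken pure.
  refine DFunLike.congr_fun (f := (theta (blockPerm σ τ)).comp (mulRight k b))
    (g := (mulRight k (theta τ b)).comp (theta σ)) (hom_ext fun x => ?_) a
  refine DFunLike.congr_fun (f := (theta (blockPerm σ τ)).comp (mulLeft l (tprod 𝕜 x)))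
    (g := (mulLeft l (theta σ (tprod 𝕜 x))).comp (theta τ)) (hom_ext fun y => ?_) b
  simp only [ContinuousLinearMap.comp_apply, mulLeft_apply, theta_tprod, mul_tprod,
    append_blockPerm_inv]

theorem theta_blockSwap_mul {k l : ℕ} (a : CompletedPow 𝕜 V k) (b : CompletedPow 𝕜 V l) :
    theta (blockSwap k l) (mul a b) = cast (Nat.add_comm l k) (mul b a) := by
  refine DFunLike.congr_fun (f := (theta (blockSwap k l)).comp (mulRight k b))
    (g := (cast (Nat.add_comm l k)).comp (mulLeft k b)) (hom_ext fun x => ?_) a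
  refine DFunLike.congr_fun (f := (theta (blockSwap k l)).comp (mulLeft l (tprod 𝕜 x)))
    (g := (cast (Nat.add_comm l k)).comp (mulRight l (tprod 𝕜 x))) (hom_ext fun y => ?_) b
  simp only [ContinuousLinearMap.comp_apply, mulLeft_apply, mulRight_apply, theta_tprod,
    mul_tprod, append_blockSwap_inv, cast_tprod]

theorem mul_assoc {k l m : ℕ} (a : CompletedPow 𝕜 V k) (b : CompletedPow 𝕜 V l)
    (c : CompletedPow 𝕜 V m) :
    mul a (mul b c) = cast (Nat.add_assoc k l m) (mul (mul a b) c) := by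
  refine DFunLike.congr_fun (f := mulRight k (mul b c))
    (g := ((cast (Nat.add_assoc k l m)).comp (mulRight _ c)).comp (mulRight k b))
    (hom_ext fun x => ?_) a
  refine DFunLike.congr_fun (f := (mulLeft _ (tprod 𝕜 x)).comp (mulRight l c))
    (g := ((cast (Nat.add_assoc k l m)).comp (mulRight _ c)).comp (mulLeft l (tprod 𝕜 x)))
    (hom_ext fun y => ?_) b
  refine DFunLike.congr_fun (f := (mulLeft _ (tprod 𝕜 x)).comp (mulLeft m (tprod 𝕜 y)))
    (g := (cast (Nat.add_assoc k l m)).comp (mulLeft m (mul (tprod 𝕜 x) (tprod 𝕜 y))))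
    (hom_ext fun z => ?_) c
  simp only [ContinuousLinearMap.comp_apply, mulLeft_apply, mul_tprod, cast_tprod,
    Fin.append_assoc]
  rfl

/-- The empty tensor, which corresponds to `1` in `𝕜`, is a unit for concatenation. -/
theorem cast_mul_tprod_zero {k : ℕ} (a : CompletedPow 𝕜 V k) (x : Fin 0 → V) :
    cast (Nat.add_zero k) (mul a (tprod 𝕜 x)) = a := by
  refine DFunLike.congr_fun (f := (cast (Nat.add_zero k)).comp (mulRight k (tprod 𝕜 x)))
    (g := ContinuousLinearMap.id 𝕜 _) (hom_ext fun y => ?_) a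
  simp only [ContinuousLinearMap.comp_apply, mulRight_apply, mul_tprod, cast_tprod,
    ContinuousLinearMap.id_apply]
  congr 1
  funext i
  exact Fin.append_left y x i

theorem cast_tprod_zero_mul {k : ℕ} (a : CompletedPow 𝕜 V k) (x : Fin 0 → V) :
    cast (Nat.zero_add k) (mul (tprod 𝕜 x) a) = a := by
  refine DFunLike.congr_fun (f := (cast (Nat.zero_add k)).comp (mulLeft k (tprod 𝕜 x)))
    (g := ContinuousLinearMap.id 𝕜 _) (hom_ext fun y => ?_) a
  simp only [ContinuousLinearMap.comp_apply, mulLeft_apply, mul_tprod, cast_tprod,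
    ContinuousLinearMap.id_apply]
  congr 1
  funext i
  rw [← Fin.append_right x y i]
  congr 1
  ext
  simp

end CompletedPow

open CompletedPow

/-! ### The operations on continuous linear maps and the ProP axioms. -/

namespace HomC

variable [IsTopologicalAddGroup V] [PolynormableSpace 𝕜 V]

/-- The horizontal concatenation `f ⊗̂ g`. -/
def hcomp {k l k' l' : ℕ} :
    HomC 𝕜 V k l →ₗ[𝕜] HomC 𝕜 V k' l' →ₗ[𝕜] HomC 𝕜 V (k + k') (l + l') :=
  LinearMap.mk₂ 𝕜
    (fun f g => (mulEquiv 𝕜 V l l').toContinuousLinearMap.comp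
      ((CompletedTensor.map f g).comp (mulEquiv 𝕜 V k k').symm.toContinuousLinearMap))
    (fun f f' g => by
      ext z
      simp only [CompletedTensor.map_add_left, ContinuousLinearMap.comp_apply,
        add_apply, map_add])
    (fun c f g => by
      ext z
      simp only [CompletedTensor.map_smul_left, ContinuousLinearMap.comp_apply,
        smul_apply, map_smul])
    (fun f g g' => by
      ext z
      simp only [CompletedTensor.map_add_right, ContinuousLinearMap.comp_apply,
        add_apply, map_add])
    (fun c f g => by
      ext z
      simp only [CompletedTensor.map_smul_right, ContinuousLinearMap.comp_apply,
        smul_apply, map_smul])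

theorem hcomp_mulEquiv {k l k' l' : ℕ} (f : HomC 𝕜 V k l) (g : HomC 𝕜 V k' l')
    (z : CompletedTensor 𝕜 (CompletedPow 𝕜 V k) (CompletedPow 𝕜 V k')) :
    hcomp f g (mulEquiv 𝕜 V k k' z) = mulEquiv 𝕜 V l l' (CompletedTensor.map f g z) :=
  congrArg (fun z => mulEquiv 𝕜 V l l' (CompletedTensor.map f g z))
    ((mulEquiv 𝕜 V k k').symm_apply_apply z)

/-- Together with `hom_ext_mul`, this rule characterizes `hcomp`; the axioms on horizontal
concatenation are deduced from it. -/
theorem hcomp_mul {k l k' l' : ℕ} (f : HomC 𝕜 V k l) (g : HomC 𝕜 V k' l')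
    (a : CompletedPow 𝕜 V k) (b : CompletedPow 𝕜 V k') :
    hcomp f g (mul a b) = mul (f a) (g b) := by
  rw [mul, hcomp_mulEquiv, CompletedTensor.map_tmul]
  rfl

variable (𝕜 V) in
/-- The operations of the ProP `Hom^c_V`. -/
def propData : ProPData 𝕜 (HomC 𝕜 V) where
  lact σ :=
    { toFun := fun f => (theta σ).comp f
      map_add' := fun f g => ContinuousLinearMap.comp_add _ f g
      map_smul' := fun c f => ContinuousLinearMap.comp_smul _ c f }
  ract τ :=
    { toFun := fun f => f.comp (theta τ)
      map_add' := fun f g => ContinuousLinearMap.add_comp f g _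
      map_smul' := fun c f => ContinuousLinearMap.smul_comp c f _ }
  hcomp := hcomp
  I₀ := ContinuousLinearMap.id 𝕜 _
  vcomp := LinearMap.mk₂ 𝕜 (fun f g => f.comp g)
    (fun f f' g => ContinuousLinearMap.add_comp f f' g)
    (fun c f g => ContinuousLinearMap.smul_comp c f g)
    (fun f g g' => ContinuousLinearMap.comp_add f g g')
    (fun c f g => ContinuousLinearMap.comp_smul f c g)
  I₁ := ContinuousLinearMap.id 𝕜 _

theorem propData_idn (n : ℕ) : (propData 𝕜 V).idn n = ContinuousLinearMap.id 𝕜 _ := by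
  induction n with
  | zero => rfl
  | succ n ih =>
    refine hom_ext_mul fun a b => ?_
    rw [ProPData.idn, ih]
    exact hcomp_mul _ _ a b

theorem hcomp_assoc {k l k' l' k'' l'' : ℕ} (p : HomC 𝕜 V k l) (p' : HomC 𝕜 V k' l')
    (p'' : HomC 𝕜 V k'' l'') :
    hcomp p (hcomp p' p'') =
      castIdx (Nat.add_assoc k k' k'') (Nat.add_assoc l l' l'') (hcomp (hcomp p p') p'') := by
  refine hom_ext_mul fun a z => ?_
  -- With `a` fixed, the second factor is itself split as a concatenation of `b` and `c`.
  refine DFunLike.congr_fun (f := (hcomp p (hcomp p' p'')).comp (mulLeft _ a))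
    (g := ContinuousLinearMap.comp
      (castIdx (P := HomC 𝕜 V) (Nat.add_assoc k k' k'') (Nat.add_assoc l l' l'')
        (hcomp (hcomp p p') p'')) (mulLeft _ a)) (hom_ext_mul fun b c => ?_) z
  simp only [ContinuousLinearMap.comp_apply, mulLeft_apply]
  -- The argument is rebracketed as the cast of `(a ⊗ b) ⊗ c`, the form on which the transported map
  -- can be evaluated.
  conv_rhs => rw [CompletedPow.mul_assoc a b c, castIdx_apply_cast]
  simp only [hcomp_mul]
  exact CompletedPow.mul_assoc _ _ _

theorem hcomp_id_zero {k l : ℕ} (p : HomC 𝕜 V k l) :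
    castIdx (Nat.add_zero k) (Nat.add_zero l)
      (hcomp p (ContinuousLinearMap.id 𝕜 (CompletedPow 𝕜 V 0))) = p := by
  ext z
  -- Appending the empty tensor to `z` exhibits it as the cast of a concatenation.
  conv_lhs => rw [← cast_mul_tprod_zero z Fin.elim0]
  rw [castIdx_apply_cast, hcomp_mul, ContinuousLinearMap.id_apply, cast_mul_tprod_zero]

theorem id_zero_hcomp {k l : ℕ} (p : HomC 𝕜 V k l) :
    castIdx (Nat.zero_add k) (Nat.zero_add l)
      (hcomp (ContinuousLinearMap.id 𝕜 (CompletedPow 𝕜 V 0)) p) = p := by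
  ext z
  conv_lhs => rw [← cast_tprod_zero_mul z Fin.elim0]
  rw [castIdx_apply_cast, hcomp_mul, ContinuousLinearMap.id_apply, cast_tprod_zero_mul]

/-- Both sides send `a ⊗ b` to the cast of `p' b ⊗ p a`. -/
theorem hcomp_comm {k k' l l' : ℕ} (p : HomC 𝕜 V k l) (p' : HomC 𝕜 V k' l') :
    (theta (blockSwap l l')).comp (hcomp p p') =
      ContinuousLinearMap.comp
        (castIdx (P := HomC 𝕜 V) (Nat.add_comm k' k) (Nat.add_comm l' l) (hcomp p' p))
        (theta (blockSwap k k')) :=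
  hom_ext_mul fun a b => by
    rw [ContinuousLinearMap.comp_apply, ContinuousLinearMap.comp_apply, hcomp_mul,
      theta_blockSwap_mul, theta_blockSwap_mul, castIdx_apply_cast, hcomp_mul]

variable (𝕜 V) in
/-- The ProP `Hom^c_V`. -/
def prop : ProP 𝕜 (HomC 𝕜 V) where
  toProPData := propData 𝕜 V
  one_lact p := by
    change (theta 1).comp p = p
    rw [theta_one, ContinuousLinearMap.id_comp]
  ract_one p := by
    change p.comp (theta 1) = p
    rw [theta_one, ContinuousLinearMap.comp_id]
  lact_lact σ σ' p := by
    change (theta σ).comp ((theta σ').comp p) = (theta (σ * σ')).comp p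
    rw [← ContinuousLinearMap.comp_assoc, theta_comp_theta]
  lact_ract _ _ _ := rfl
  ract_ract τ τ' p := by
    change (p.comp (theta τ)).comp (theta τ') = p.comp (theta (τ * τ'))
    rw [ContinuousLinearMap.comp_assoc, theta_comp_theta]
  hcomp_assoc := hcomp_assoc
  hcomp_I₀ := hcomp_id_zero
  I₀_hcomp := id_zero_hcomp
  vcomp_assoc _ _ _ := rfl
  vcomp_idn {k l} p := by
    rw [propData_idn]
    exact p.comp_id
  idn_vcomp {k l} p := by
    rw [propData_idn]
    exact p.id_comp
  hcomp_vcomp_hcomp p p' q q' := hom_ext_mul fun a b => by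
    change hcomp p p' (hcomp q q' (mul a b)) = hcomp (p.comp q) (p'.comp q') (mul a b)
    simp only [hcomp_mul, ContinuousLinearMap.comp_apply]
  lact_vcomp _ _ _ := rfl
  vcomp_ract _ _ _ := rfl
  ract_vcomp _ _ _ := rfl
  lact_hcomp σ σ' p p' := hom_ext_mul fun a b => by
    change hcomp ((theta σ).comp p) ((theta σ').comp p') (mul a b) =
      theta (blockPerm σ σ') (hcomp p p' (mul a b))
    simp only [hcomp_mul, ContinuousLinearMap.comp_apply, theta_mul]
  hcomp_ract τ τ' p p' := hom_ext_mul fun a b => by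
    change hcomp (p.comp (theta τ)) (p'.comp (theta τ')) (mul a b) =
      hcomp p p' (theta (blockPerm τ τ') (mul a b))
    simp only [hcomp_mul, ContinuousLinearMap.comp_apply, theta_mul]
  hcomp_comm := hcomp_comm

end HomC

end HomC

/-! ### The canonical isomorphisms in exponents zero and one. -/

section LowPowers

variable {𝕜 : Type v} [RCLike 𝕜] {V : Type u} [AddCommGroup V] [Module 𝕜 V]

/-- The canonical isomorphism `V^{⊗̂ 0} = 𝕜`. -/
theorem CompletedPow.exists_zeroEquiv [TopologicalSpace V] :
    ∃ e : CompletedPow 𝕜 V 0 ≃L[𝕜] 𝕜, ∀ x : Fin 0 → V, e (CompletedPow.tprod 𝕜 x) = 1 := by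
  let f : CompletedPow 𝕜 V 0 →L[𝕜] 𝕜 :=
    CompletedPow.lift (MultilinearMap.constOfIsEmpty 𝕜 _ 1) continuous_const
  have hf : ∀ x : Fin 0 → V, f (CompletedPow.tprod 𝕜 x) = 1 := CompletedPow.lift_tprod _ _
  let g : 𝕜 →L[𝕜] CompletedPow 𝕜 V 0 :=
    (ContinuousLinearMap.id 𝕜 𝕜).smulRight (CompletedPow.tprod 𝕜 Fin.elim0)
  have hgf : g.comp f = ContinuousLinearMap.id 𝕜 _ := CompletedPow.hom_ext fun x => by
    rw [ContinuousLinearMap.comp_apply, hf, Subsingleton.elim x Fin.elim0]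
    simp [g]
  exact ⟨ContinuousLinearEquiv.equivOfInverse f g (DFunLike.congr_fun hgf)
    fun c => by simp [g, hf], hf⟩

/-- The canonical isomorphism `V^{⊗̂ 1} = V`. -/
theorem CompletedPow.exists_oneEquiv [UniformSpace V] [IsUniformAddGroup V] [ContinuousSMul 𝕜 V]
    [T2Space V] [CompleteSpace V] [PolynormableSpace 𝕜 V] :
    ∃ e : CompletedPow 𝕜 V 1 ≃L[𝕜] V, ∀ x : Fin 1 → V, e (CompletedPow.tprod 𝕜 x) = x 0 := by
  -- The extension to the completion takes values in `V` itself because `V` is complete and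
  -- Hausdorff.
  let f : CompletedPow 𝕜 V 1 →L[𝕜] V :=
    CompletedPow.lift (MultilinearMap.ofSubsingleton 𝕜 V V (0 : Fin 1) LinearMap.id)
      (continuous_apply 0)
  have hf : ∀ x : Fin 1 → V, f (CompletedPow.tprod 𝕜 x) = x 0 := CompletedPow.lift_tprod _ _
  let g : V →L[𝕜] CompletedPow 𝕜 V 1 :=
    { toLinearMap := (toComplCLM (𝕜 := 𝕜)).toLinearMap ∘ₗ
        (MultilinearMap.ofSubsingleton 𝕜 V _ (0 : Fin 1)).symm (TensorPow.tprod 𝕜 V 1)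
      cont := CompletedPow.continuous_tprod.comp (continuous_pi fun _ => continuous_id) }
  have hg : ∀ v, g v = CompletedPow.tprod 𝕜 fun _ => v := fun _ => rfl
  have hgf : g.comp f = ContinuousLinearMap.id 𝕜 _ := CompletedPow.hom_ext fun x => by
    rw [ContinuousLinearMap.comp_apply, hf, hg, ContinuousLinearMap.id_apply]
    congr 1
    funext i
    rw [Subsingleton.elim i 0]
  exact ⟨ContinuousLinearEquiv.equivOfInverse f g (DFunLike.congr_fun hgf)
    fun v => by rw [hg, hf], hf⟩

end LowPowers

end
theorem mainTheorem11 {𝕜 : Type v} [RCLike 𝕜] {V : Type u} [AddCommGroup V] [Module 𝕜 V]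
    [UniformSpace V] [IsUniformAddGroup V] [ContinuousSMul 𝕜 V]
    (hF : IsFrechet 𝕜 V) (hN : IsNuclear 𝕜 V) :
    -- the canonical identifications `V^{⊗̂ 0} = 𝕜`, `V^{⊗̂ 1} = V` and
    -- `V^{⊗̂ k} ⊗̂ V^{⊗̂ l} = V^{⊗̂ (k + l)}`, each determined by its values on pure tensors
    ∃ (e₀ : CompletedPow 𝕜 V 0 ≃L[𝕜] 𝕜) (e₁ : CompletedPow 𝕜 V 1 ≃L[𝕜] V)
      (μ : ∀ k l : ℕ,
        CompletedTensor 𝕜 (CompletedPow 𝕜 V k) (CompletedPow 𝕜 V l) ≃L[𝕜]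
          CompletedPow 𝕜 V (k + l)),
      (∀ x : Fin 0 → V, e₀ (CompletedPow.tprod 𝕜 x) = 1) ∧
      (∀ x : Fin 1 → V, e₁ (CompletedPow.tprod 𝕜 x) = x 0) ∧
      (∀ (k l : ℕ) (x : Fin k → V) (y : Fin l → V),
        μ k l (CompletedTensor.tmul 𝕜 (CompletedPow.tprod 𝕜 x) (CompletedPow.tprod 𝕜 y)) =
          CompletedPow.tprod 𝕜 (Fin.append x y)) ∧
      -- the ProP structure on `Hom^c_V`
      ∃ P : ProP 𝕜 (HomC 𝕜 V),
        (∀ (k l : ℕ) (σ : Equiv.Perm (Fin l)) (f : HomC 𝕜 V k l),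
          P.lact σ f = (CompletedPow.theta σ).comp f) ∧
        (∀ (k l : ℕ) (τ : Equiv.Perm (Fin k)) (f : HomC 𝕜 V k l),
          P.ract τ f = f.comp (CompletedPow.theta τ)) ∧
        (∀ (k l k' l' : ℕ) (f : HomC 𝕜 V k l) (g : HomC 𝕜 V k' l')
            (z : CompletedTensor 𝕜 (CompletedPow 𝕜 V k) (CompletedPow 𝕜 V k')),
          P.hcomp f g (μ k k' z) = μ l l' (CompletedTensor.map f g z)) ∧
        (∀ (k l m : ℕ) (f : HomC 𝕜 V l m) (g : HomC 𝕜 V k l), P.vcomp f g = f.comp g) ∧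
        (∀ c : 𝕜, e₀ (P.I₀ (e₀.symm c)) = c) ∧
        (∀ v : V, e₁ (P.I₁ (e₁.symm v)) = v) := by
  obtain ⟨_, _, _⟩ := hF
  obtain ⟨e₀, he₀⟩ := CompletedPow.exists_zeroEquiv (𝕜 := 𝕜) (V := V)
  obtain ⟨e₁, he₁⟩ := CompletedPow.exists_oneEquiv (𝕜 := 𝕜) (V := V)
  -- The isomorphism `μ` must be the one that defines `hcomp`, which makes the clause on `P.hcomp` a
  -- cancellation. As `I₀` and `I₁` are identity maps, the last two clauses say only that `e₀` and
  -- `e₁` invert their inverses.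
  exact ⟨e₀, e₁, CompletedPow.mulEquiv 𝕜 V, he₀, he₁, fun _ _ => CompletedPow.mul_tprod,
    HomC.prop 𝕜 V, fun _ _ _ _ => rfl, fun _ _ _ _ => rfl,
    fun _ _ _ _ => HomC.hcomp_mulEquiv, fun _ _ _ _ _ => rfl,
    e₀.apply_symm_apply, e₁.apply_symm_apply⟩
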